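/- Model. A network is a finite connected undirected graph $G=(V,E)$ with $n=|V|$ devices, one at each vertex; the devices carry distinct identifiers in $\{1,\dots,N\}$. Time is divided into synchronous slots, with a common time zero. In each slot a device either sends one message (of unbounded size), or listens, or stays idle; sending and listening each cost one unit of energy, idling and local computation are free. In the $\mathsf{LOCAL}$ model a device that listens hears every message sent in that slot by any of its neighbors (there are no collisions), and a device that sends or is idle gets no feedback. In a deterministic algorithm all devices run the same deterministic program; initially a device knows only $n$, $N$, its own identifier, and whether it is the source. In the problem $\mathsf{Broadcast}$, one source device $s\in V$ holds a message $m$ at time zero, and at the end every device must have halted with output $m$. The time of an execution is the number of slots until all devices have halted; its energy is the maximum, over all devices, of the number of slots in which the device sends or listens. Theorem. There is a deterministic algorithm that solves $\mathsf{Broadcast}$ in the $\mathsf{LOCAL}$ model in $O(n\log n\log N)$ time with $O(\log n\log N)$ energy. That is, there is an absolute constant $C>0$ such that, on every connected network with $n$ devices, for every assignment of distinct identifiers from $\{1,\dots,N\}$, every source $s$ and every message $m$, the algorithm solves $\mathsf{Broadcast}$ in time at most $C\,n\log_2 n\,\log_2 N$, and each device spends energy at most $C\log_2 n\,\log_2 N$.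 -/

import Mathlib

universe u v

/-- What a device does in one time slot: send a message, listen, or stay idle. -/
inductive RadioAction (Msg : Type u) : Type u
  | send (msg : Msg)
  | listen
  | idle

/-- A deterministic distributed algorithm whose input at the source, and whose output at every
device, is a message from `M`.  All devices run the same algorithm; local computation is
unrestricted and free.
* `init n N i x` is the state at time zero of a device with identifier `i` in a network with `n`
  devices and identifier space `{1, …, N}`; `x = some m` if the device is the source and holds `m`,
  and `x = none` otherwise.  A device knows nothing else about the network.
* `action` is what a device in a given state does in the current slot.
* `next σ r` is the state after the slot.  A device that listened gets `r = some R`, where `R` is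
  the multiset of messages that it heard; a device that sent or was idle gets no feedback,
  `r = none`.
* A device whose state has `output σ = some m` has halted with output `m`. -/
structure RadioAlgorithm (M : Type u) where
  State : Type u
  Msg : Type u
  init : (n N i : ℕ) → (x : Option M) → State
  action : State → RadioAction Msg
  next : State → Option (Multiset Msg) → State
  output : State → Option M

namespace RadioAlgorithm

variable {M : Type u} (A : RadioAlgorithm M)

/-- The action actually performed in state `σ`: a device that has halted stays idle. -/
def performed (σ : A.State) : RadioAction A.Msg :=
  match A.output σ with
  | some _ => RadioAction.idle
  | none => A.action σ

/-- The message sent in state `σ`, if any. -/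
def sent (σ : A.State) : Option A.Msg :=
  match A.performed σ with
  | RadioAction.send msg => some msg
  | _ => none

variable {V : Type v} [Fintype V]

open Classical in
/-- The feedback to device `v` in one slot of the `LOCAL` model, where `c` is the current
configuration: a listener hears every message transmitted by any neighbor, and a device that does
not listen gets no feedback (in particular a sender hears nothing in that slot). -/
noncomputable def feedback (G : SimpleGraph V) (c : V → A.State) (v : V) :
    Option (Multiset A.Msg) :=
  match A.performed (c v) with
  | RadioAction.listen => some ((G.neighborFinset v).val.filterMap fun w => A.sent (c w))
  | _ => none

/-- One synchronous slot in the `LOCAL` model.  The state of a halted device no longer changes. -/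
noncomputable def step (G : SimpleGraph V) (c : V → A.State) (v : V) : A.State :=
  match A.output (c v) with
  | some _ => c v
  | none => A.next (c v) (A.feedback G c v)

open Classical in
/-- The configuration at time `t` of the execution in the `LOCAL` model on the network `G`, with
identifiers `ident` from `{1, …, N}`, when the source `s` holds the message `m`. -/
noncomputable def run (G : SimpleGraph V) (N : ℕ) (ident : V → ℕ) (s : V) (m : M) :
    ℕ → V → A.State
  | 0, v => A.init (Fintype.card V) N (ident v) (if v = s then some m else none)
  | t + 1, v => A.step G (run G N ident s m t) v

open Classical in
/-- The energy spent by device `v` in the first `t` slots: the number of these slots in which it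
sends or listens. -/
noncomputable def energy (G : SimpleGraph V) (N : ℕ) (ident : V → ℕ) (s : V) (m : M)
    (t : ℕ) (v : V) : ℕ :=
  ((Finset.range t).filter fun i =>
    A.performed (A.run G N ident s m i v) ≠ RadioAction.idle).card

end RadioAlgorithm

/-! The devices maintain a partition into clusters, each with a unique root and layers in which
every non-root has a neighbor one layer closer to the root. Layers are below `n`, so sweeping a
cluster up to its root and back takes O(`n`) slots. A device is awake only when its own layer or an
adjacent one transmits, hence for O(1) slots (`cost_gather_le`). One such sweep lets all devices of
a cluster agree on a value (`gatherSpec`), and one extra slot across cluster borders makes clusters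
behave like single vertices of the quotient graph (`hopSpec`).

A phase merges clusters. Going through the `b` = O(log `N`) bits of the cluster names, candidates
whose bit is 1 give up if a candidate with bit 0 is at most two hops away. The survivors are
pairwise at least three hops apart, and each bit costs at most two hops of domination, so every
cluster is within 2`b` hops of a survivor (`IsRuling.succ`). New clusters then grow around the
survivors in 2`b` waves (`grown_wave`). If at least two clusters exist, connectivity gives each
survivor a neighboring cluster, which is no survivor and is shared with no other survivor; hence the
number of clusters halves (`card_image_le_half`).

After about log `n` phases a single cluster remains, and one more sweep delivers the message. A
phase takes O(`n` log `N`) slots and O(log `N`) energy, which gives both bounds. New layers must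
again form a layering: tokens carry a hop counter, and the chain property in `GatherSpec` says that
each counter is either original or one more than that of a neighbor in the cluster. -/

namespace ClusterBroadcast

/-! ### Fixed schedules of slots, realized as a `RadioAlgorithm` -/

open Classical in
/-- A fixed choice of an element of a set, if there is one. -/
noncomputable def pick {α : Type*} (S : Set α) : Option α :=
  if h : S.Nonempty then some h.choose else none

theorem mem_of_pick_eq_some {α : Type*} {S : Set α} {a : α} (h : pick S = some a) : a ∈ S := by
  unfold pick at h
  split_ifs at h with hS
  rw [← Option.some.inj h]
  exact hS.choose_spec

theorem pick_eq_none_iff {α : Type*} {S : Set α} : pick S = none ↔ S = ∅ := by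
  unfold pick
  split_ifs with hS
  · simpa using hS.ne_empty
  · simpa [Set.not_nonempty_iff_eq_empty] using hS

/-- The part of the memory of a device that is not used by the intra-cluster communication. -/
structure Core (M : Type u) : Type u where
  /-- the message to be broadcast, if known -/
  msg : Option M
  /-- the name of the cluster of the device -/
  cid : ℕ
  /-- the layer of the device in its cluster -/
  dep : ℕ
  /-- whether the cluster is a candidate for the ruling set -/
  cand : Prop
  /-- whether the cluster is adjacent to a candidate that suppresses others -/
  near : Prop
  /-- whether the cluster has been assigned to a new cluster -/
  asg : Prop
  /-- the name of the new cluster -/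
  ncid : ℕ
  /-- the layer in the new cluster -/
  nlab : ℕ

/-- A value passed around in a cluster: a payload, and a counter for the hops traversed. -/
abbrev Token (M : Type u) : Type u := (ℕ × Option M) × ℕ

/-- The memory of a device. -/
structure Dev (M : Type u) : Type u where
  core : Core M
  /-- the value collected on the way to the root -/
  val : Option (Token M)
  /-- the value distributed by the root -/
  res : Option (Token M)

/-- The behavior of the devices in one slot: those with `snd` transmit their memory, the others
with `lis` listen, and the memory is updated with the set of messages heard. -/
structure Slot (M : Type u) : Type u where
  snd : Dev M → Prop
  lis : Dev M → Prop
  upd : Dev M → Set (Dev M) → Dev M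

variable {M : Type u} {V : Type v}

/-- The set of messages heard by `v`. -/
def heard (G : SimpleGraph V) (s : Slot M) (c : V → Dev M) (v : V) : Set (Dev M) :=
  {x | (¬ s.snd (c v) ∧ s.lis (c v)) ∧ ∃ w, G.Adj v w ∧ s.snd (c w) ∧ c w = x}

/-- The effect of one slot. -/
def Slot.exec (G : SimpleGraph V) (s : Slot M) (c : V → Dev M) (v : V) : Dev M :=
  s.upd (c v) (heard G s c v)

/-- The effect of a sequence of slots. -/
def exec (G : SimpleGraph V) (p : List (Slot M)) (c : V → Dev M) : V → Dev M :=
  p.foldl (fun c s => s.exec G c) c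

open Classical in
/-- The energy that `v` spends in a sequence of slots. -/
noncomputable def cost (G : SimpleGraph V) : List (Slot M) → (V → Dev M) → V → ℕ
  | [], _, _ => 0
  | s :: p, c, v => (if s.snd (c v) ∨ s.lis (c v) then 1 else 0) + cost G p (s.exec G c) v

@[simp] theorem exec_nil (G : SimpleGraph V) (c : V → Dev M) : exec G [] c = c := rfl

@[simp] theorem exec_cons (G : SimpleGraph V) (s : Slot M) (p : List (Slot M)) (c : V → Dev M) :
    exec G (s :: p) c = exec G p (s.exec G c) := rfl

@[simp] theorem exec_append (G : SimpleGraph V) (p q : List (Slot M)) (c : V → Dev M) :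
    exec G (p ++ q) c = exec G q (exec G p c) := by
  simp [exec]

@[simp] theorem cost_append (G : SimpleGraph V) (p q : List (Slot M)) (c : V → Dev M) (v : V) :
    cost G (p ++ q) c v = cost G p c v + cost G q (exec G p c) v := by
  induction p generalizing c with
  | nil => simp [cost]
  | cons s p ih => simp [cost, ih, add_assoc]

/-- The memory of a device at time zero. -/
def initDev (i : ℕ) (x : Option M) : Dev M :=
  ⟨⟨x, i, 0, True, False, False, 0, 0⟩, none, none⟩

open Classical in
/-- The algorithm in which all devices run the program `prog n N` and then output `msg`. -/
noncomputable def ofProgram (M : Type u) (prog : ℕ → ℕ → List (Slot M)) : RadioAlgorithm M where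
  State := List (Slot M) × Dev M
  Msg := Dev M
  init n N i x := (prog n N, initDev i x)
  action σ := match σ.1 with
    | [] => RadioAction.idle
    | s :: _ => if s.snd σ.2 then RadioAction.send σ.2
        else if s.lis σ.2 then RadioAction.listen else RadioAction.idle
  next σ r := match σ.1 with
    | [] => σ
    | s :: p => (p, s.upd σ.2 {x | ∃ R ∈ r, x ∈ R})
  output σ := match σ.1 with
    | [] => σ.2.core.msg
    | _ :: _ => none

variable [Fintype V]

theorem performed_cons (prog : ℕ → ℕ → List (Slot M)) (s : Slot M) (p : List (Slot M))
    (x : Dev M) [Decidable (s.snd x)] [Decidable (s.lis x)] :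
    (ofProgram M prog).performed (s :: p, x) =
      if s.snd x then RadioAction.send x
        else if s.lis x then RadioAction.listen else RadioAction.idle := by
  simp only [RadioAlgorithm.performed, ofProgram]
  congr

/-- All devices share the same remaining schedule, and none has halted while it is nonempty. Of the
multiset that a listener receives, only the support is used. -/
theorem step_cons (prog : ℕ → ℕ → List (Slot M)) (G : SimpleGraph V) (s : Slot M)
    (p : List (Slot M)) (c : V → Dev M) (v : V) :
    (ofProgram M prog).step G (fun w => (s :: p, c w)) v = (p, s.exec G c v) := by
  classical
  change (p, s.upd (c v) _) = _
  congr 2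
  ext x
  have hsent : ∀ w, (ofProgram M prog).sent (s :: p, c w) =
      if s.snd (c w) then some (c w) else none := by
    intro w
    unfold RadioAlgorithm.sent
    rw [performed_cons]
    split_ifs <;> rfl
  rw [heard, Set.mem_ofPred_eq, Set.mem_ofPred_eq]
  unfold RadioAlgorithm.feedback
  rw [performed_cons]
  split_ifs with h1 h2
  · exact iff_of_false (fun ⟨_, h, _⟩ => nomatch h) (fun h => h.1.1 h1)
  · simp only [hsent]
    constructor
    · rintro ⟨R, hR, hx⟩
      obtain rfl := Option.some.inj hR
      obtain ⟨w, hw, hx⟩ := (Multiset.mem_filterMap _ _).1 hx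
      split_ifs at hx with hs
      exact ⟨⟨h1, h2⟩, w, by simpa using hw, hs, Option.some.inj hx⟩
    · rintro ⟨-, w, hw, hs, hx⟩
      exact ⟨_, rfl, (Multiset.mem_filterMap _ _).2 ⟨w, by simpa using hw, by rw [if_pos hs, hx]⟩⟩
  · exact iff_of_false (fun ⟨_, h, _⟩ => nomatch h) (fun h => h2 h.1.2)

section Run

open Classical in
/-- The configuration at time zero. -/
noncomputable def initConfig (ident : V → ℕ) (s : V) (m : M) (v : V) : Dev M :=
  initDev (ident v) (if v = s then some m else none)

variable (prog : ℕ → ℕ → List (Slot M)) (G : SimpleGraph V) (N : ℕ) (ident : V → ℕ) (s : V) (m : M)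

theorem run_eq (t : ℕ) (ht : t ≤ (prog (Fintype.card V) N).length) :
    (ofProgram M prog).run G N ident s m t = fun v => ((prog (Fintype.card V) N).drop t,
      exec G ((prog (Fintype.card V) N).take t) (initConfig ident s m) v) := by
  induction t with
  | zero => rfl
  | succ t ih =>
    funext v
    rw [RadioAlgorithm.run, ih (by omega), List.drop_eq_getElem_cons (by omega), step_cons,
      List.take_succ_eq_append_getElem (by omega), exec_append]
    rfl

/-- Energy already spent plus the cost of the remaining slots is invariant in `t`; this links the
two recursions, which peel slots off opposite ends. -/
theorem energy_add_cost (t : ℕ) (ht : t ≤ (prog (Fintype.card V) N).length) (v : V) :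
    (ofProgram M prog).energy G N ident s m t v +
      cost G ((prog (Fintype.card V) N).drop t)
        (exec G ((prog (Fintype.card V) N).take t) (initConfig ident s m)) v =
      cost G (prog (Fintype.card V) N) (initConfig ident s m) v := by
  classical
  induction t with
  | zero => simp [RadioAlgorithm.energy]
  | succ t ih =>
    rw [← ih (by omega), List.drop_eq_getElem_cons (show t < _ by omega), cost,
      List.take_succ_eq_append_getElem (by omega), exec_append, ← add_assoc]
    congr 1
    rw [RadioAlgorithm.energy, RadioAlgorithm.energy, Finset.range_add_one, Finset.filter_insert,
      run_eq prog G N ident s m t (by omega)]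
    rw [List.drop_eq_getElem_cons (show t < _ by omega), performed_cons]
    split_ifs with h1 h2 h3 h4 h5 h6 <;> first | simp_all; done | exact absurd rfl ‹_ ≠ _›

theorem output_run_length (w : V) :
    (ofProgram M prog).output ((ofProgram M prog).run G N ident s m
      (prog (Fintype.card V) N).length w) =
      (exec G (prog (Fintype.card V) N) (initConfig ident s m) w).core.msg := by
  rw [run_eq prog G N ident s m _ le_rfl]
  simp [ofProgram]

theorem energy_length_le (w : V) :
    (ofProgram M prog).energy G N ident s m (prog (Fintype.card V) N).length w ≤
      cost G (prog (Fintype.card V) N) (initConfig ident s m) w := by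
  rw [← energy_add_cost prog G N ident s m _ le_rfl w]
  exact Nat.le_add_right _ _

end Run

end ClusterBroadcast
-- The quotient graph of clusters, layerings, and the halving argument
namespace ClusterBroadcast
variable {V : Type v}

/-- The clusters of `x` and `y` contain adjacent devices. -/
def ClusterAdj (G : SimpleGraph V) (cid : V → ℕ) (x y : V) : Prop :=
  ∃ x' y', cid x' = cid x ∧ cid y' = cid y ∧ G.Adj x' y'

/-- The clusters of `x` and `y` are at most `k` hops apart. -/
def ClusterDistLE (G : SimpleGraph V) (cid : V → ℕ) : ℕ → V → V → Prop
  | 0, x, y => cid x = cid y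
  | k + 1, x, y => ClusterDistLE G cid k x y ∨
      ∃ z, ClusterAdj G cid x z ∧ ClusterDistLE G cid k z y

/-- Layers that connect every device to the root of its cluster, which is unique. -/
structure IsLayering (G : SimpleGraph V) (cid dep : V → ℕ) : Prop where
  exists_parent : ∀ x, 0 < dep x → ∃ y, G.Adj x y ∧ cid y = cid x ∧ dep y + 1 = dep x
  root_unique : ∀ x y, cid x = cid y → dep x = 0 → dep y = 0 → x = y

variable {G : SimpleGraph V} {cid dep : V → ℕ}

theorem ClusterAdj.symm {x y : V} (h : ClusterAdj G cid x y) : ClusterAdj G cid y x := by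
  obtain ⟨x', y', hx, hy, ha⟩ := h
  exact ⟨y', x', hy, hx, ha.symm⟩

theorem ClusterAdj.congr_left {x y z : V} (h : ClusterAdj G cid x y) (hz : cid z = cid x) :
    ClusterAdj G cid z y := by
  obtain ⟨x', y', hx, hy, ha⟩ := h
  exact ⟨x', y', hx.trans hz.symm, hy, ha⟩

theorem ClusterAdj.congr_right {x y z : V} (h : ClusterAdj G cid x y) (hz : cid z = cid y) :
    ClusterAdj G cid x z :=
  (h.symm.congr_left hz).symm

theorem _root_.SimpleGraph.Adj.clusterAdj {x y : V} (h : G.Adj x y) : ClusterAdj G cid x y :=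
  ⟨x, y, rfl, rfl, h⟩

theorem ClusterDistLE.succ {k : ℕ} {x y : V} (h : ClusterDistLE G cid k x y) :
    ClusterDistLE G cid (k + 1) x y := Or.inl h

theorem ClusterDistLE.congr_left {k : ℕ} {x y z : V} (h : ClusterDistLE G cid k x y)
    (hz : cid z = cid x) : ClusterDistLE G cid k z y := by
  induction k generalizing x z with
  | zero => exact hz.trans h
  | succ k ih =>
    rcases h with h | ⟨w, hw, h⟩
    · exact Or.inl (ih h hz)
    · exact Or.inr ⟨w, hw.congr_left hz, h⟩

theorem ClusterDistLE.mono {k l : ℕ} {x y : V} (h : ClusterDistLE G cid k x y) (hkl : k ≤ l) :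
    ClusterDistLE G cid l x y := by
  induction hkl with
  | refl => exact h
  | step _ ih => exact ih.succ

theorem ClusterDistLE.trans {k l : ℕ} {x y z : V} (h : ClusterDistLE G cid k x y)
    (h' : ClusterDistLE G cid l y z) : ClusterDistLE G cid (k + l) x z := by
  induction k generalizing x with
  | zero => exact (h'.congr_left h).mono (by omega)
  | succ k ih =>
    rw [Nat.add_right_comm]
    rcases h with h | ⟨w, hw, h⟩
    · exact Or.inl (ih h)
    · exact Or.inr ⟨w, hw, ih h⟩

theorem IsLayering.exists_dep_eq (h : IsLayering G cid dep) (x : V) (k : ℕ) (hk : k ≤ dep x) :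
    ∃ y, cid y = cid x ∧ dep y = k := by
  induction hk using Nat.decreasingInduction with
  | self => exact ⟨x, rfl, rfl⟩
  | of_succ j hj ih =>
    obtain ⟨y, hy, hd⟩ := ih
    obtain ⟨z, -, hz, hzd⟩ := h.exists_parent y (by omega)
    exact ⟨z, hz.trans hy, by omega⟩

/-- Following parents from `x` visits every smaller layer, so `dep x + 1` distinct devices exist.
Thus sweeps over `n` layers suffice however clusters have grown. -/
theorem IsLayering.dep_lt_card [Fintype V] (h : IsLayering G cid dep) (x : V) :
    dep x < Fintype.card V := by
  classical
  have hsub : Finset.range (dep x + 1) ⊆ Finset.univ.image dep := by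
    intro k hk
    obtain ⟨y, -, hy⟩ := h.exists_dep_eq x k (by simpa [Nat.lt_succ_iff] using hk)
    exact Finset.mem_image.2 ⟨y, Finset.mem_univ _, hy⟩
  have := (Finset.card_le_card hsub).trans Finset.card_image_le
  simpa [Nat.succ_le_iff] using this

/-- Otherwise the cluster of `x` would be closed under adjacency, and a walk from `x` to `y` could
never leave it. -/
theorem exists_clusterAdj_ne (hG : G.Connected) {x y : V} (hxy : cid x ≠ cid y) :
    ∃ w, ClusterAdj G cid x w ∧ cid w ≠ cid x := by
  by_contra! hcon
  obtain ⟨p⟩ := hG.preconnected x y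
  have key : ∀ {a b : V}, G.Walk a b → cid a = cid x → cid b = cid x := by
    intro a b q
    induction q with
    | nil => exact id
    | cons hab _ ih => exact fun ha => ih (hcon _ (hab.clusterAdj.congr_left ha.symm))
  exact hxy (key p rfl).symm

/-- If the clusters in `R` are pairwise at least three hops apart and the new clusters are named
after them, then the number of clusters is halved. -/
theorem card_image_le_half [Fintype V] (hG : G.Connected) {R : V → Prop} {new : V → ℕ}
    (hR : ∀ x y, R x → R y → cid x ≠ cid y →
      ¬ ClusterAdj G cid x y ∧ ∀ w, ¬ (ClusterAdj G cid x w ∧ ClusterAdj G cid w y))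
    (hnew : ∀ v, ∃ r, R r ∧ cid r = new v) :
    (Finset.univ.image new).card ≤ max 1 ((Finset.univ.image cid).card / 2) := by
  classical
  by_cases hall : ∀ x y, cid x = cid y
  · refine le_max_of_le_left (Finset.card_le_one.2 ?_)
    simp only [Finset.mem_image, Finset.mem_univ, true_and]
    rintro _ ⟨a, rfl⟩ _ ⟨b, rfl⟩
    obtain ⟨r, -, hr⟩ := hnew a
    obtain ⟨r', -, hr'⟩ := hnew b
    rw [← hr, ← hr', hall r r']
  push Not at hall
  obtain ⟨a, b, hab⟩ := hall
  refine le_max_of_le_right ?_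
  set K := Finset.univ.image cid with hK
  set S := K.filter fun k => ∃ r, R r ∧ cid r = k with hS
  have hle : (Finset.univ.image new).card ≤ S.card := by
    refine Finset.card_le_card ?_
    intro k hk
    obtain ⟨v, -, rfl⟩ := Finset.mem_image.1 hk
    obtain ⟨r, hr, hrv⟩ := hnew v
    exact Finset.mem_filter.2 ⟨Finset.mem_image.2 ⟨r, Finset.mem_univ _, hrv⟩, r, hr, hrv⟩
  -- `w` represents a foreign cluster adjacent to the ruling cluster named `k`; for other `k` it is
  -- arbitrary.
  have hnb : ∀ k, ∃ w, ∀ r, R r → cid r = k → ClusterAdj G cid r w ∧ cid w ≠ cid r := by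
    intro k
    by_cases hk : ∃ r, R r ∧ cid r = k
    · obtain ⟨r, hr, rfl⟩ := hk
      have : ∃ y, cid r ≠ cid y := by
        by_contra! h
        exact hab ((h a).symm.trans (h b))
      obtain ⟨y, hy⟩ := this
      obtain ⟨w, hw, hne⟩ := exists_clusterAdj_ne hG hy
      exact ⟨w, fun r' _ h' => ⟨hw.congr_left h', h' ▸ hne⟩⟩
    · exact ⟨a, fun r hr hk' => absurd ⟨r, hr, hk'⟩ hk⟩
  choose f hf using hnb
  -- The chosen neighbor is not ruling, because ruling clusters are not adjacent, and two ruling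
  -- clusters cannot share it, because they are not two hops apart.
  have hinj : S.card ≤ (K \ S).card := by
    refine Finset.card_le_card_of_injOn (fun k => cid (f k)) ?_ ?_
    · intro k hk
      obtain ⟨-, r, hr, rfl⟩ := Finset.mem_filter.1 hk
      obtain ⟨h1, h2⟩ := hf _ r hr rfl
      refine Finset.mem_sdiff.2 ⟨Finset.mem_image_of_mem _ (Finset.mem_univ _), fun h => ?_⟩
      obtain ⟨-, r', hr', h'⟩ := Finset.mem_filter.1 h
      exact (hR r r' hr hr' (by rw [h']; exact h2.symm)).1 (h1.congr_right h')
    · intro k hk l hl hkl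
      obtain ⟨-, r, hr, rfl⟩ := Finset.mem_filter.1 hk
      obtain ⟨-, r', hr', rfl⟩ := Finset.mem_filter.1 hl
      by_contra hne
      exact (hR r r' hr hr' hne).2 _ ⟨(hf _ r hr rfl).1,
        (((hf _ r' hr' rfl).1.congr_right hkl)).symm⟩
  have := Finset.card_sdiff_add_card_eq_card (show S ⊆ K from Finset.filter_subset _ _)
  omega

end ClusterBroadcast
-- Agreement inside a cluster by one sweep up and one sweep down
namespace ClusterBroadcast
variable {M : Type u} {V : Type v}

/-- The names of the clusters of the devices. -/
abbrev cids (c : V → Dev M) (v : V) : ℕ := (c v).core.cid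

/-- The layers of the devices. -/
abbrev deps (c : V → Dev M) (v : V) : ℕ := (c v).core.dep

/-- Layer `d` transmits to layer `d - 1`: a device without a value adopts one that it hears. -/
noncomputable def upSlot (M : Type u) (d : ℕ) : Slot M where
  snd x := x.core.dep = d
  lis x := x.core.dep + 1 = d
  upd x R :=
    let S := {q | ∃ y ∈ R, y.core.cid = x.core.cid ∧ ∃ p k, y.val = some (p, k) ∧ q = (p, k + 1)}
    { x with val := x.val.or (pick S) }

/-- Layers `k, k - 1, …, 1` transmit upwards in turn. -/
noncomputable def ups (M : Type u) : ℕ → List (Slot M)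
  | 0 => []
  | k + 1 => upSlot M (k + 1) :: ups M k

/-- The root adopts its own value as the result. -/
noncomputable def rootSlot (M : Type u) : Slot M where
  snd _ := False
  lis _ := False
  -- Non-roots are cleared, so that results of an earlier sweep cannot survive.
  upd x _ := { x with res := if x.core.dep = 0 then x.val else none }

open Classical in
/-- The result of a device with value `v` whose parent has result `q`. -/
noncomputable def relay (v : Option (Token M)) (q : Token M) : Token M :=
  -- A device that already holds the chosen payload keeps its own counter; this preserves the path
  -- along which the payload climbed.
  if ∃ k, v = some (q.1, k) then v.getD q else (q.1, q.2 + 1)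

/-- Layer `d - 1` transmits its results to layer `d`. -/
noncomputable def downSlot (M : Type u) (d : ℕ) : Slot M where
  snd x := x.core.dep + 1 = d
  lis x := x.core.dep = d
  upd x R :=
    let S := {q | ∃ y ∈ R, y.core.cid = x.core.cid ∧ y.res = some q}
    { x with res := ((pick S).map (relay x.val)).or x.res }

/-- Layers `0, 1, …, k - 1` transmit downwards in turn. -/
noncomputable def downs (M : Type u) : ℕ → List (Slot M)
  | 0 => []
  | k + 1 => downs M k ++ [downSlot M (k + 1)]

/-- All devices of a cluster agree on one of their values. -/
noncomputable def gather (M : Type u) (n : ℕ) : List (Slot M) :=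
  ups M n ++ ([rootSlot M] ++ downs M n)

theorem relay_fst (v : Option (Token M)) (q : Token M) : (relay v q).1 = q.1 := by
  unfold relay
  split_ifs with h
  · obtain ⟨k, rfl⟩ := h
    rfl
  · rfl

theorem relay_some (p : ℕ × Option M) (k k' : ℕ) : relay (some (p, k)) (p, k') = (p, k) := by
  unfold relay
  rw [if_pos ⟨k, rfl⟩]
  rfl

theorem relay_eq (v : Option (Token M)) (q : Token M) :
    v = some (relay v q) ∨ relay v q = (q.1, q.2 + 1) := by
  unfold relay
  split_ifs with h
  · obtain ⟨k, rfl⟩ := h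
    exact Or.inl rfl
  · exact Or.inr rfl

variable (G : SimpleGraph V)

theorem heard_upSlot (d : ℕ) (c : V → Dev M) (x : V) :
    heard G (upSlot M d) c x =
      {y | deps c x + 1 = d ∧ ∃ w, G.Adj x w ∧ deps c w = d ∧ c w = y} := by
  ext y
  simp only [heard, upSlot, Set.mem_ofPred_eq]
  constructor
  · rintro ⟨⟨-, h⟩, h'⟩
    exact ⟨h, h'⟩
  · rintro ⟨h, h'⟩
    exact ⟨⟨fun h0 : deps c x = d => by omega, h⟩, h'⟩

theorem heard_downSlot (d : ℕ) (c : V → Dev M) (x : V) :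
    heard G (downSlot M d) c x =
      {y | deps c x = d ∧ ∃ w, G.Adj x w ∧ deps c w + 1 = d ∧ c w = y} := by
  ext y
  simp only [heard, downSlot, Set.mem_ofPred_eq]
  constructor
  · rintro ⟨⟨-, h⟩, h'⟩
    exact ⟨h, h'⟩
  · rintro ⟨h, h'⟩
    exact ⟨⟨fun h0 : deps c x + 1 = d => by omega, h⟩, h'⟩

/-- The set of tokens offered to `x` by its children. -/
def childTokens (c : V → Dev M) (x : V) : Set (Token M) :=
  {q | ∃ y, G.Adj x y ∧ cids c y = cids c x ∧ deps c y = deps c x + 1 ∧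
    ∃ p k, (c y).val = some (p, k) ∧ q = (p, k + 1)}

/-- The set of results offered to `x` by its parents. -/
def parentTokens (c : V → Dev M) (x : V) : Set (Token M) :=
  {q | ∃ y, G.Adj x y ∧ cids c y = cids c x ∧ deps c y + 1 = deps c x ∧ (c y).res = some q}

theorem upSlot_exec (d : ℕ) (c : V → Dev M) (x : V) :
    (deps c x + 1 = d → (upSlot M d).exec G c x =
      { c x with val := (c x).val.or (pick (childTokens G c x)) }) ∧
    (deps c x + 1 ≠ d → (upSlot M d).exec G c x = c x) := by
  rw [Slot.exec, heard_upSlot]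
  constructor
  · intro h
    simp only [upSlot]
    congr 3
    ext q
    simp only [childTokens, Set.mem_ofPred_eq]
    constructor
    · rintro ⟨_, ⟨-, w, hw, hd, rfl⟩, h1, h2⟩
      exact ⟨w, hw, h1, hd.trans h.symm, h2⟩
    · rintro ⟨w, hw, h1, hd, h2⟩
      exact ⟨_, ⟨h, w, hw, hd.trans h, rfl⟩, h1, h2⟩
  · intro h
    simp only [upSlot]
    rw [pick_eq_none_iff.2, Option.or_none]
    ext q
    simp [h]

theorem downSlot_exec (d : ℕ) (c : V → Dev M) (x : V) :
    (deps c x = d → (downSlot M d).exec G c x =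
      { c x with res := ((pick (parentTokens G c x)).map (relay (c x).val)).or (c x).res }) ∧
    (deps c x ≠ d → (downSlot M d).exec G c x = c x) := by
  rw [Slot.exec, heard_downSlot]
  constructor
  · intro h
    simp only [downSlot]
    congr 4
    ext q
    simp only [parentTokens, Set.mem_ofPred_eq]
    constructor
    · rintro ⟨_, ⟨-, w, hw, hd, rfl⟩, h1, h2⟩
      exact ⟨w, hw, h1, hd.trans h.symm, h2⟩
    · rintro ⟨w, hw, h1, hd, h2⟩
      exact ⟨_, ⟨h, w, hw, hd.trans h, rfl⟩, h1, h2⟩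
  · intro h
    simp only [downSlot]
    rw [pick_eq_none_iff.2, Option.map_none, Option.none_or]
    ext q
    simp [h]

theorem ups_core (k : ℕ) (c : V → Dev M) (x : V) : (exec G (ups M k) c x).core = (c x).core := by
  induction k generalizing c with
  | zero => rfl
  | succ k ih => exact ih _

theorem downs_core (k : ℕ) (c : V → Dev M) (x : V) :
    (exec G (downs M k) c x).core = (c x).core := by
  induction k with
  | zero => rfl
  | succ k ih =>
    rw [downs, exec_append]
    exact ih

theorem downs_val (k : ℕ) (c : V → Dev M) (x : V) :
    (exec G (downs M k) c x).val = (c x).val := by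
  induction k with
  | zero => rfl
  | succ k ih =>
    rw [downs, exec_append]
    exact ih

theorem gather_core (n : ℕ) (c : V → Dev M) (x : V) :
    (exec G (gather M n) c x).core = (c x).core := by
  rw [gather, exec_append, exec_append, downs_core, ← ups_core G n c x]
  rfl

theorem childTokens_congr {c c' : V → Dev M} (hc : ∀ y, (c' y).core = (c y).core) {x : V}
    (hv : ∀ y, deps c y = deps c x + 1 → (c' y).val = (c y).val) :
    childTokens G c' x = childTokens G c x := by
  ext q
  simp only [childTokens, cids, deps, hc, Set.mem_ofPred_eq]
  refine exists_congr fun y => and_congr_right fun _ => and_congr_right fun _ =>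
    and_congr_right fun hd => ?_
  rw [hv y hd]

theorem parentTokens_congr {c c' : V → Dev M} (hc : ∀ y, (c' y).core = (c y).core) {x : V}
    (hv : ∀ y, deps c y + 1 = deps c x → (c' y).res = (c y).res) :
    parentTokens G c' x = parentTokens G c x := by
  ext q
  simp only [parentTokens, cids, deps, hc, Set.mem_ofPred_eq]
  refine exists_congr fun y => and_congr_right fun _ => and_congr_right fun _ =>
    and_congr_right fun hd => ?_
  rw [hv y hd]

/-- Deeper layers transmit first, so the values of the children are final when `x` listens. This
permits an equation purely in terms of the final configuration; `downs_res` is the mirror image. -/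
theorem ups_val (k : ℕ) (c : V → Dev M) (x : V) :
    (deps c x < k → (exec G (ups M k) c x).val =
      (c x).val.or (pick (childTokens G (exec G (ups M k) c) x))) ∧
    (k ≤ deps c x → (exec G (ups M k) c x).val = (c x).val) := by
  induction k generalizing c x with
  | zero => exact ⟨fun h => absurd h (Nat.not_lt_zero _), fun _ => rfl⟩
  | succ k ih =>
    rw [ups, exec_cons]
    set c1 := (upSlot M (k + 1)).exec G c with hc1
    have hcore : ∀ y, (c1 y).core = (c y).core := fun _ => rfl
    have hdep : ∀ y, deps c1 y = deps c y := fun _ => rfl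
    have h1 := upSlot_exec G (k + 1) c x
    rw [← hc1] at h1
    have h2 := ih c1 x
    refine ⟨fun hx => ?_, fun hx => ?_⟩
    · rcases Nat.lt_succ_iff_lt_or_eq.1 hx with hlt | heq
      · rw [h2.1 (by rw [hdep]; exact hlt), h1.2 (by omega)]
      · rw [h2.2 (by rw [hdep]; omega), h1.1 (by omega),
          childTokens_congr G (c := c) (fun y => (ups_core G k c1 y).trans (hcore y))]
        intro y hy
        rw [(ih c1 y).2 (by rw [hdep]; omega), hc1, (upSlot_exec G (k + 1) c y).2 (by omega)]
    · rw [h2.2 (by rw [hdep]; omega), h1.2 (by omega)]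

theorem downs_res (k : ℕ) (c : V → Dev M) (x : V) :
    (0 < deps c x → deps c x ≤ k → (exec G (downs M k) c x).res =
      ((pick (parentTokens G (exec G (downs M k) c) x)).map (relay (c x).val)).or (c x).res) ∧
    (deps c x = 0 ∨ k < deps c x → (exec G (downs M k) c x).res = (c x).res) := by
  induction k generalizing x with
  | zero => exact ⟨fun h h' => by omega, fun _ => rfl⟩
  | succ k ih =>
    rw [downs, exec_append, exec_cons, exec_nil]
    set c1 := exec G (downs M k) c with hc1
    have hcore : ∀ y, (c1 y).core = (c y).core := downs_core G k c
    have hdep : ∀ y, deps c1 y = deps c y := fun y => by rw [deps, hcore]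
    have h1 := downSlot_exec G (k + 1) c1
    have hpar : ∀ x, deps c x ≤ k + 1 →
        parentTokens G ((downSlot M (k + 1)).exec G c1) x = parentTokens G c1 x := by
      intro x hx
      refine parentTokens_congr G (c := c1)
        (c' := (downSlot M (k + 1)).exec G c1) (fun _ => rfl) fun y hy => ?_
      rw [(h1 y).2]
      rw [hdep] at hy ⊢
      rw [hdep] at hy
      omega
    refine ⟨fun h0 hx => ?_, fun hx => ?_⟩
    · rw [hpar x hx]
      rcases Nat.le_succ_iff.1 hx with hlt | heq
      · rw [(h1 x).2 (by rw [hdep]; omega), (ih x).1 h0 hlt]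
      · rw [(h1 x).1 (by rw [hdep]; omega), (ih x).2 (by omega), downs_val]
    · rw [(h1 x).2 (by rw [hdep]; omega), (ih x).2 (by omega)]

/-- What the intra-cluster communication achieves. -/
structure GatherSpec (c c' : V → Dev M) : Prop where
  core_eq : ∀ x, (c' x).core = (c x).core
  res_ne_none : ∀ x y, cids c y = cids c x → (c y).val ≠ none → (c' x).res ≠ none
  exists_val : ∀ x p k, (c' x).res = some (p, k) →
    ∃ y, cids c y = cids c x ∧ ∃ k', (c y).val = some (p, k')
  payload_eq : ∀ x y, cids c x = cids c y → (c' x).res.map Prod.fst = (c' y).res.map Prod.fst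
  chain : ∀ x p k, (c' x).res = some (p, k) → (c x).val = some (p, k) ∨
    ∃ y k', G.Adj x y ∧ cids c y = cids c x ∧ (c' y).res = some (p, k') ∧ k = k' + 1

variable [Fintype V]

/-- Any value in a cluster forces a value at its root, and every result has the payload of the root.
For the chain property, a counter is inherited either from a parent on the way down or from a child
on the way up; in the latter case `relay` ensures that the child still shows the counter it sent. -/
theorem gatherSpec {c : V → Dev M} (h : IsLayering G (cids c) (deps c)) :
    GatherSpec G c (exec G (gather M (Fintype.card V)) c) := by
  set n := Fintype.card V with hn
  set c1 := exec G (ups M n) c with hc1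
  set c2 := (rootSlot M).exec G c1 with hc2
  set c' := exec G (gather M n) c with hc'
  have e' : c' = exec G (downs M n) c2 := by rw [hc', gather, exec_append, exec_append]; rfl
  have core1 : ∀ x, (c1 x).core = (c x).core := ups_core G n c
  have core2 : ∀ x, (c2 x).core = (c x).core := core1
  have core' : ∀ x, (c' x).core = (c x).core := gather_core G n c
  have val2 : ∀ x, (c2 x).val = (c1 x).val := fun _ => rfl
  have res2 : ∀ x, (c2 x).res = if deps c x = 0 then (c1 x).val else none := by
    intro x
    rw [deps, ← core1]
    rfl
  have hval : ∀ x, (c1 x).val = (c x).val.or (pick (childTokens G c1 x)) :=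
    fun x => (ups_val G n c x).1 (h.dep_lt_card x)
  have hd2 : ∀ x, deps c2 x = deps c x := fun x => by rw [deps, core2]
  have hres0 : ∀ x, deps c x = 0 → (c' x).res = (c1 x).val := by
    intro x hx
    rw [e', (downs_res G n c2 x).2 (Or.inl ((hd2 x).trans hx)), res2, if_pos hx]
  have hres1 : ∀ x, 0 < deps c x →
      (c' x).res = (pick (parentTokens G c' x)).map (relay (c1 x).val) := by
    intro x hx
    rw [e', (downs_res G n c2 x).1 (by rwa [hd2]) (by rw [hd2]; exact (h.dep_lt_card x).le), res2,
      if_neg hx.ne', Option.or_none, val2]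
  -- the parent of `x` whose result determines the result of `x`
  have hpar : ∀ x q, 0 < deps c x → (c' x).res = some q → ∃ y q', G.Adj x y ∧
      cids c y = cids c x ∧ deps c y + 1 = deps c x ∧ (c' y).res = some q' ∧
      q = relay (c1 x).val q' := by
    intro x q hx hq
    rw [hres1 x hx] at hq
    obtain ⟨q', hq', rfl⟩ := Option.map_eq_some_iff.1 hq
    obtain ⟨y, hy, h1, h2, h3⟩ := mem_of_pick_eq_some hq'
    simp only [cids, deps, core'] at h1 h2
    exact ⟨y, q', hy, h1, h2, h3, rfl⟩
  have hnone : ∀ x y, G.Adj x y → cids c y = cids c x → deps c y + 1 = deps c x →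
      (c' x).res = none → (c' y).res = none := by
    intro x y hxy h1 h2 hx
    rw [hres1 x (by omega), Option.map_eq_none_iff, pick_eq_none_iff] at hx
    by_contra hy
    obtain ⟨q, hq⟩ := Option.ne_none_iff_exists'.1 hy
    have : q ∈ parentTokens G c' x := ⟨y, hxy, by simpa [cids, core'] using h1,
      by simpa [deps, core'] using h2, hq⟩
    rw [hx] at this
    exact this
  have hroot : ∀ d x r, deps c x = d → cids c r = cids c x → deps c r = 0 →
      (c' x).res.map Prod.fst = (c1 r).val.map Prod.fst := by
    intro d
    induction d with
    | zero =>
      intro x r hx hr hr0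
      rw [h.root_unique r x hr hr0 hx, hres0 x hx]
    | succ d ih =>
      intro x r hx hr hr0
      rcases hq : (c' x).res with _ | q
      · obtain ⟨y, hy, h1, h2⟩ := h.exists_parent x (by omega)
        rw [← ih y r (by omega) (hr.trans h1.symm) hr0, hnone x y hy h1 h2 hq]
      · obtain ⟨y, q', hy, h1, h2, h3, rfl⟩ := hpar x q (by omega) hq
        rw [← ih y r (by omega) (hr.trans h1.symm) hr0, h3, Option.map_some, Option.map_some,
          relay_fst]
  have hpay : ∀ x y, cids c x = cids c y →
      (c' x).res.map Prod.fst = (c' y).res.map Prod.fst := by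
    intro x y hxy
    obtain ⟨r, hr, hr0⟩ := h.exists_dep_eq x 0 (Nat.zero_le _)
    rw [hroot _ x r rfl hr hr0, hroot _ y r rfl (hr.trans hxy) hr0]
  have hup : ∀ d y, deps c y = d → (c1 y).val ≠ none → ∀ r, cids c r = cids c y → deps c r = 0 →
      (c1 r).val ≠ none := by
    intro d
    induction d with
    | zero =>
      intro y hy hv r hr hr0
      rwa [h.root_unique r y hr hr0 hy]
    | succ d ih =>
      intro y hy hv r hr hr0
      obtain ⟨z, hz, h1, h2⟩ := h.exists_parent y (by omega)
      refine ih z (by omega) ?_ r (hr.trans h1.symm) hr0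
      intro hz0
      rw [hval, Option.or_eq_none_iff, pick_eq_none_iff] at hz0
      obtain ⟨⟨p, k⟩, hpk⟩ := Option.ne_none_iff_exists'.1 hv
      have : (p, k + 1) ∈ childTokens G c1 z := ⟨y, hz.symm, by simpa [cids, core1] using h1.symm,
        by simpa [deps, core1] using h2.symm, p, k, hpk, rfl⟩
      rw [hz0.2] at this
      exact this
  have hvalsplit : ∀ x p k, (c1 x).val = some (p, k) → (c x).val = some (p, k) ∨
      ∃ y k', G.Adj x y ∧ cids c y = cids c x ∧ deps c y = deps c x + 1 ∧
        (c1 y).val = some (p, k') ∧ k = k' + 1 := by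
    intro x p k hx
    rw [hval, Option.or_eq_some_iff] at hx
    rcases hx with hx | ⟨-, hx⟩
    · exact Or.inl hx
    · obtain ⟨y, hy, h1, h2, p', k', h3, h4⟩ := mem_of_pick_eq_some hx
      simp only [cids, deps, core1] at h1 h2
      obtain ⟨rfl, rfl⟩ := Prod.mk.inj h4
      exact Or.inr ⟨y, k', hy, h1, h2, h3, rfl⟩
  -- Tracing a value to its origin goes one layer deeper each time, and no layer reaches `n`; `j`
  -- measures what is left.
  have horig : ∀ j x p k, n ≤ deps c x + j → (c1 x).val = some (p, k) →
      ∃ y, cids c y = cids c x ∧ ∃ k', (c y).val = some (p, k') := by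
    intro j
    induction j with
    | zero => exact fun x p k hx => absurd (h.dep_lt_card x) (by omega)
    | succ j ih =>
      intro x p k hx hp
      rcases hvalsplit x p k hp with hp | ⟨y, k', -, h1, h2, h3, -⟩
      · exact ⟨x, rfl, k, hp⟩
      · obtain ⟨z, hz, hz'⟩ := ih y p k' (by omega) h3
        exact ⟨z, hz.trans h1, hz'⟩
  refine ⟨core', ?_, ?_, hpay, ?_⟩
  · intro x y hxy hy hx
    obtain ⟨r, hr, hr0⟩ := h.exists_dep_eq y 0 (Nat.zero_le _)
    have hy1 : (c1 y).val ≠ none := by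
      rw [hval, Ne, Option.or_eq_none_iff]
      exact fun h' => hy h'.1
    have := hroot _ x r rfl (hr.trans hxy) hr0
    rw [hx, Option.map_none, eq_comm, Option.map_eq_none_iff] at this
    exact hup _ y rfl hy1 r hr hr0 this
  · intro x p k hx
    obtain ⟨r, hr, hr0⟩ := h.exists_dep_eq x 0 (Nat.zero_le _)
    have := hroot _ x r rfl hr hr0
    rw [hx, Option.map_some, eq_comm, Option.map_eq_some_iff] at this
    obtain ⟨⟨p', k'⟩, hk, rfl⟩ := this
    obtain ⟨y, hy, hy'⟩ := horig n r p' k' (by omega) hk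
    exact ⟨y, hy.trans hr, hy'⟩
  -- A device that held the winning payload after the upward sweep ends with exactly that token,
  -- counter included.
  · have hkey : ∀ x p k, (c1 x).val = some (p, k) →
        (c' x).res.map Prod.fst = some p → (c' x).res = some (p, k) := by
      intro x p k hx hp
      rcases Nat.eq_zero_or_pos (deps c x) with h0 | h0
      · rw [hres0 x h0, hx]
      · obtain ⟨q, hq, rfl⟩ := Option.map_eq_some_iff.1 hp
        obtain ⟨y, q', -, -, -, -, rfl⟩ := hpar x q h0 hq
        rw [relay_fst] at hx ⊢
        rw [hq, hx]
        exact congrArg some (relay_some _ _ _)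
    have hmain : ∀ x p k, (c' x).res = some (p, k) → (c1 x).val = some (p, k) →
        (c x).val = some (p, k) ∨ ∃ y k', G.Adj x y ∧ cids c y = cids c x ∧
          (c' y).res = some (p, k') ∧ k = k' + 1 := by
      intro x p k hx hv
      rcases hvalsplit x p k hv with hv | ⟨y, k', h0, h1, h2, h3, h4⟩
      · exact Or.inl hv
      · refine Or.inr ⟨y, k', h0, h1, hkey y p k' h3 ?_, h4⟩
        rw [hpay y x h1, hx]
        rfl
    intro x p k hx
    rcases Nat.eq_zero_or_pos (deps c x) with h0 | h0
    · exact hmain x p k hx (by rw [← hres0 x h0, hx])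
    · obtain ⟨y, ⟨p', k'⟩, hy, h1, h2, h3, h4⟩ := hpar x _ h0 hx
      rcases relay_eq (c1 x).val (p', k') with h5 | h5
      · exact hmain x p k hx (by rw [h4]; exact h5)
      · rw [h5] at h4
        obtain ⟨rfl, rfl⟩ := Prod.mk.inj h4
        exact Or.inr ⟨y, k', hy, h1, h3, rfl⟩

end ClusterBroadcast
-- Communication between clusters, and ruling sets bit by bit
namespace ClusterBroadcast
variable {M : Type u} {V : Type v}

/-- Devices with `snd` announce their new cluster and layer to their neighbors. -/
noncomputable def borderSlot (snd : Core M → Prop) : Slot M where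
  snd x := snd x.core
  lis _ := True
  upd x R :=
    let S := {q | ∃ y ∈ R, q = ((y.core.ncid, none), y.core.nlab + 1)}
    { x with val := pick S }

/-- The clusters with `snd` make an announcement, and every other cluster agrees on one of the
announcements that it hears. -/
noncomputable def hop (n : ℕ) (snd : Core M → Prop) : List (Slot M) :=
  borderSlot snd :: gather M n

/-- A slot without communication. -/
def localSlot (f : Core M → Option (Token M) → Core M) : Slot M where
  snd _ := False
  lis _ := False
  upd x _ := { x with core := f x.core x.res }

/-- What `hop` achieves when the clusters with `P` make an announcement. -/
structure HopSpec (G : SimpleGraph V) (P : V → Prop) (c c' : V → Dev M) : Prop where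
  core_eq : ∀ x, (c' x).core = (c x).core
  res_ne_none_iff : ∀ x, (c' x).res ≠ none ↔ ∃ y u, cids c y = cids c x ∧ ¬ P y ∧ G.Adj y u ∧ P u
  exists_ncid : ∀ x p k, (c' x).res = some (p, k) → ∃ u, P u ∧ (c u).core.ncid = p.1
  payload_eq : ∀ x y, cids c x = cids c y → (c' x).res.map Prod.fst = (c' y).res.map Prod.fst
  chain : ∀ x p k, (c' x).res = some (p, k) →
    (∃ u, G.Adj x u ∧ P u ∧ (c u).core.ncid = p.1 ∧ k = (c u).core.nlab + 1) ∨
    ∃ y k', G.Adj x y ∧ cids c y = cids c x ∧ (c' y).res = some (p, k') ∧ k = k' + 1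

variable (G : SimpleGraph V)

/-- Senders hear nothing, so only devices outside `P` acquire a value at the border, with a counter
one above the announced layer. The rest is `gatherSpec`. -/
theorem hopSpec [Fintype V] {c : V → Dev M} (h : IsLayering G (cids c) (deps c))
    (snd : Core M → Prop) :
    HopSpec G (fun v => snd (c v).core) c (exec G (hop (Fintype.card V) snd) c) := by
  rw [hop, exec_cons]
  set c1 := (borderSlot snd).exec G c with hc1
  set c' := exec G (gather M (Fintype.card V)) c1 with hc'
  have core1 : ∀ x, (c1 x).core = (c x).core := fun _ => rfl
  have g : GatherSpec G c1 c' := gatherSpec G h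
  have hmem : ∀ x y, y ∈ heard G (borderSlot snd) c x ↔
      ¬ snd (c x).core ∧ ∃ u, G.Adj x u ∧ snd (c u).core ∧ c u = y := by
    intro x y
    simp [heard, borderSlot]
  have hval : ∀ x p k, (c1 x).val = some (p, k) → ¬ snd (c x).core ∧
      ∃ u, G.Adj x u ∧ snd (c u).core ∧ (c u).core.ncid = p.1 ∧ k = (c u).core.nlab + 1 := by
    intro x p k hx
    obtain ⟨y, hy, hpk⟩ := mem_of_pick_eq_some hx
    obtain ⟨h0, u, hu, hs, rfl⟩ := (hmem x y).1 hy
    obtain ⟨rfl, rfl⟩ := Prod.mk.inj hpk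
    exact ⟨h0, u, hu, hs, rfl, rfl⟩
  have hval' : ∀ x u, ¬ snd (c x).core → G.Adj x u → snd (c u).core → (c1 x).val ≠ none := by
    intro x u h0 hu hs hx
    have := pick_eq_none_iff.1 hx
    exact Set.eq_empty_iff_forall_notMem.1 this _ ⟨c u, (hmem x _).2 ⟨h0, u, hu, hs, rfl⟩, rfl⟩
  refine ⟨fun x => (g.core_eq x).trans (core1 x), fun x => ⟨fun hx => ?_, ?_⟩, fun x p k hx => ?_,
    g.payload_eq, fun x p k hx => ?_⟩
  · obtain ⟨⟨p, k⟩, hpk⟩ := Option.ne_none_iff_exists'.1 hx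
    obtain ⟨y, hy, k', hk'⟩ := g.exists_val x p k hpk
    obtain ⟨h0, u, hu, hs, -⟩ := hval y p k' hk'
    exact ⟨y, u, hy, h0, hu, hs⟩
  · rintro ⟨y, u, hy, h0, hu, hs⟩
    exact g.res_ne_none x y hy (hval' y u h0 hu hs)
  · obtain ⟨y, hy, k', hk'⟩ := g.exists_val x p k hx
    obtain ⟨-, u, -, hs, h1, -⟩ := hval y p k' hk'
    exact ⟨u, hs, h1⟩
  · rcases g.chain x p k hx with h1 | h1
    · exact Or.inl (hval x p k h1).2
    · exact Or.inr h1

/-- The property `P` is shared by the devices of a cluster. -/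
def Consistent (cid : V → ℕ) (P : V → Prop) : Prop := ∀ x y, cid x = cid y → P x → P y

variable {G}

theorem HopSpec.res_ne_none_iff_of_consistent {P : V → Prop} {c c' : V → Dev M}
    (h : HopSpec G P c c') (hP : Consistent (cids c) P) (x : V) :
    (c' x).res ≠ none ↔ ¬ P x ∧ ∃ u, ClusterAdj G (cids c) x u ∧ P u := by
  rw [h.res_ne_none_iff]
  constructor
  · rintro ⟨y, u, hy, h0, hu, hs⟩
    exact ⟨fun hx => h0 (hP x y hy.symm hx), u, ⟨y, u, hy, rfl, hu⟩, hs⟩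
  · rintro ⟨h0, u, ⟨y, u', hy, hu', ha⟩, hs⟩
    exact ⟨y, u', hy, fun hx => h0 (hP y x hy hx), ha, hP u u' hu'.symm hs⟩

/-- The candidate clusters with bit `j` of their name equal to `0`. -/
def suppressor (j : ℕ) (x : Core M) : Prop := x.cand ∧ x.cid.testBit j = false

/-- Candidates with bit `j` equal to `1` give up if there is a candidate with bit `j` equal to `0`
at most two hops away. -/
noncomputable def ruleStep (M : Type u) (n j : ℕ) : List (Slot M) :=
  hop n (suppressor j) ++ (localSlot (fun x r => { x with near := r ≠ none }) ::
    (hop n Core.near ++ [localSlot fun x r =>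
      { x with cand := x.cand ∧ ¬ (x.cid.testBit j = true ∧ (x.near ∨ r ≠ none)) }]))

/-- The first `j` steps of the computation of a ruling set. -/
noncomputable def rules (M : Type u) (n : ℕ) : ℕ → List (Slot M)
  | 0 => []
  | j + 1 => rules M n j ++ ruleStep M n j

/-- The message, the cluster and the layer of each device are unchanged. -/
def SameBase (c c' : V → Dev M) : Prop :=
  ∀ x, (c' x).core.msg = (c x).core.msg ∧ cids c' x = cids c x ∧ deps c' x = deps c x

theorem SameBase.trans {c c' c'' : V → Dev M} (h : SameBase c c') (h' : SameBase c' c'') :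
    SameBase c c'' := fun x =>
  ⟨(h' x).1.trans (h x).1, (h' x).2.1.trans (h x).2.1, (h' x).2.2.trans (h x).2.2⟩

theorem SameBase.cids_eq {c c' : V → Dev M} (h : SameBase c c') : cids c' = cids c :=
  funext fun x => (h x).2.1

theorem SameBase.deps_eq {c c' : V → Dev M} (h : SameBase c c') : deps c' = deps c :=
  funext fun x => (h x).2.2

/-- The clusters outside `A` that are adjacent to a cluster in `A`. -/
def NearSet (G : SimpleGraph V) (cid : V → ℕ) (A : V → Prop) (x : V) : Prop :=
  ¬ A x ∧ ∃ u, ClusterAdj G cid x u ∧ A u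

theorem Consistent.nearSet {cid : V → ℕ} {A : V → Prop} (hA : Consistent cid A) :
    Consistent cid (NearSet G cid A) := by
  rintro x y hxy ⟨h0, u, hu, hs⟩
  exact ⟨fun hy => h0 (hA y x hxy.symm hy), u, hu.congr_left hxy.symm, hs⟩

theorem ruleStep_spec [Fintype V] {c : V → Dev M} (h : IsLayering G (cids c) (deps c)) (j : ℕ)
    (hc : Consistent (cids c) fun x => (c x).core.cand) :
    let c' := exec G (ruleStep M (Fintype.card V) j) c
    let B := NearSet G (cids c) fun x => suppressor j (c x).core
    SameBase c c' ∧ ∀ x, (c' x).core.cand ↔ (c x).core.cand ∧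
      ¬ ((cids c x).testBit j = true ∧ (B x ∨ ∃ u, ClusterAdj G (cids c) x u ∧ B u)) := by
  intro c' B
  set c1 := exec G (hop (Fintype.card V) (suppressor j)) c with hc1
  set c2 := (localSlot fun x r => { x with near := r ≠ none }).exec G c1 with hc2
  set c3 := exec G (hop (Fintype.card V) Core.near) c2 with hc3
  have e' : ∀ x, (c' x).core = { (c3 x).core with cand := (c3 x).core.cand ∧
      ¬ ((c3 x).core.cid.testBit j = true ∧ ((c3 x).core.near ∨ (c3 x).res ≠ none)) } := by
    intro x
    simp only [c', ruleStep, exec_append, exec_cons, exec_nil]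
    rfl
  have s1 : HopSpec G (fun v => suppressor j (c v).core) c c1 := hopSpec G h _
  have hA : Consistent (cids c) fun x => suppressor j (c x).core := by
    rintro x y hxy ⟨h1, h2⟩
    exact ⟨hc x y hxy h1, by rw [← h2]; exact congrArg (fun i => i.testBit j) hxy.symm⟩
  have e2 : ∀ x, (c2 x).core = { (c x).core with near := (c1 x).res ≠ none } := by
    intro x
    rw [← s1.core_eq]
    rfl
  have near2 : ∀ x, (c2 x).core.near ↔ B x := by
    intro x
    rw [e2]
    exact s1.res_ne_none_iff_of_consistent hA x
  have b2 : SameBase c c2 := fun x => by simp [cids, deps, e2]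
  have s3 : HopSpec G (fun v => (c2 v).core.near) c2 c3 :=
    hopSpec G (by rw [b2.cids_eq, b2.deps_eq]; exact h) _
  have hB : Consistent (cids c2) fun x => (c2 x).core.near := by
    simp only [near2, b2.cids_eq]
    exact hA.nearSet
  have r3 := s3.res_ne_none_iff_of_consistent hB
  refine ⟨fun x => ?_, fun x => ?_⟩
  · simp only [cids, deps, e', s3.core_eq, e2, and_self]
  · rw [e']
    simp only [r3, s3.core_eq, near2, b2.cids_eq]
    have hcid : (c2 x).core.cid = cids c x := (b2 x).2.1
    have hcand : (c2 x).core.cand = (c x).core.cand := by rw [e2]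
    rw [hcid, hcand]
    -- A cluster in `B` announces in the second hop and so gets no result, but then `near` already
    -- decides.
    by_cases hBx : B x <;> simp [hBx]

/-- The candidates dominate within `2 j` hops, and those whose names differ in the first `j` bits
are at least three hops apart. -/
structure IsRuling (G : SimpleGraph V) (cid : V → ℕ) (j : ℕ) (R : V → Prop) : Prop where
  consistent : Consistent cid R
  dominating : ∀ x, ∃ u, R u ∧ ClusterDistLE G cid (2 * j) x u
  separated : ∀ x y i, R x → R y → i < j → (cid x).testBit i ≠ (cid y).testBit i →
    ¬ ClusterAdj G cid x y ∧ ∀ w, ¬ (ClusterAdj G cid x w ∧ ClusterAdj G cid w y)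

/-- Candidates with bit 0 all survive, so a candidate that gives up still has a survivor within two
hops. Survivors differing in bit `j` are far apart by the rule itself; earlier bits are inherited
since `R'` only shrinks `R`. -/
theorem IsRuling.succ {cid : V → ℕ} {j : ℕ} {R R' : V → Prop} (h : IsRuling G cid j R)
    (hR' : let B := NearSet G cid fun x => R x ∧ (cid x).testBit j = false
      ∀ x, R' x ↔ R x ∧
        ¬ ((cid x).testBit j = true ∧ (B x ∨ ∃ u, ClusterAdj G cid x u ∧ B u))) :
    IsRuling G cid (j + 1) R' := by
  have hA : Consistent cid fun x => R x ∧ (cid x).testBit j = false := by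
    rintro x y hxy ⟨h1, h2⟩
    exact ⟨h.consistent x y hxy h1, by rw [← hxy, h2]⟩
  have hB := hA.nearSet (G := G)
  -- a candidate with bit `1` does not survive close to a candidate with bit `0`
  have key : ∀ x y, R' x → R' y → (cid x).testBit j = false → (cid y).testBit j = true →
      ¬ ClusterAdj G cid y x ∧ ∀ w, ¬ (ClusterAdj G cid y w ∧ ClusterAdj G cid w x) := by
    intro x y hx hy hxj hyj
    obtain ⟨hx, -⟩ := (hR' x).1 hx
    obtain ⟨hy, hno⟩ := (hR' y).1 hy
    have h0 : ∀ u, R u ∧ (cid u).testBit j = false → ¬ ClusterAdj G cid y u := by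
      intro u hu hyu
      refine hno ⟨hyj, Or.inl ⟨fun h' => ?_, u, hyu, hu⟩⟩
      exact absurd (hyj.symm.trans h'.2) (by decide)
    refine ⟨h0 x ⟨hx, hxj⟩, fun w hw => ?_⟩
    by_cases hwA : R w ∧ (cid w).testBit j = false
    · exact h0 w hwA hw.1
    · exact hno ⟨hyj, Or.inr ⟨w, hw.1, hwA, x, hw.2, hx, hxj⟩⟩
  refine ⟨fun x y hxy hx => ?_, fun x => ?_, fun x y i hx hy hi hne => ?_⟩
  · obtain ⟨h1, h2⟩ := (hR' x).1 hx
    refine (hR' y).2 ⟨h.consistent x y hxy h1, ?_⟩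
    rintro ⟨h3, h4⟩
    refine h2 ⟨by rw [hxy, h3], ?_⟩
    rcases h4 with h4 | ⟨u, hu, h4⟩
    · exact Or.inl (hB y x hxy.symm h4)
    · exact Or.inr ⟨u, hu.congr_left hxy, h4⟩
  · have hstep : ∀ u, R u → ∃ u', R' u' ∧ ClusterDistLE G cid 2 u u' := by
      intro u hu
      by_cases hu' : R' u
      · exact ⟨u, hu', Or.inl (Or.inl rfl)⟩
      rw [hR' u] at hu'
      have hu'' := not_not.1 fun h' => hu' ⟨hu, h'⟩
      have hin : ∀ z, R z ∧ (cid z).testBit j = false → R' z := by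
        intro z hz
        refine (hR' z).2 ⟨hz.1, fun h' => ?_⟩
        rw [hz.2] at h'
        exact absurd h'.1 (by decide)
      rcases hu''.2 with ⟨-, z, hz, hzA⟩ | ⟨w, hw, -, z, hz, hzA⟩
      · exact ⟨z, hin z hzA, Or.inl (Or.inr ⟨z, hz, rfl⟩)⟩
      · exact ⟨z, hin z hzA, Or.inr ⟨w, hw, Or.inr ⟨z, hz, rfl⟩⟩⟩
    obtain ⟨u, hu, hxu⟩ := h.dominating x
    obtain ⟨u', hu', huu'⟩ := hstep u hu
    exact ⟨u', hu', hxu.trans huu'⟩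
  · rcases Nat.lt_succ_iff_lt_or_eq.1 hi with hlt | rfl
    · exact h.separated x y i ((hR' x).1 hx).1 ((hR' y).1 hy).1 hlt hne
    · rcases hxi : (cid x).testBit i with _ | _
      · have hyi : (cid y).testBit i = true := by
          rw [hxi] at hne
          simpa using hne.symm
        obtain ⟨h1, h2⟩ := key x y hx hy hxi hyi
        exact ⟨fun h' => h1 h'.symm, fun w hw => h2 w ⟨hw.2.symm, hw.1.symm⟩⟩
      · have hyi : (cid y).testBit i = false := by
          rw [hxi] at hne
          simpa using hne.symm
        exact key y x hy hx hyi hxi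

theorem rules_spec [Fintype V] {c : V → Dev M} (h : IsLayering G (cids c) (deps c))
    (hc : ∀ x, (c x).core.cand) (j : ℕ) :
    SameBase c (exec G (rules M (Fintype.card V) j) c) ∧
      IsRuling G (cids c) j fun x => (exec G (rules M (Fintype.card V) j) c x).core.cand := by
  induction j with
  | zero =>
    exact ⟨fun _ => ⟨rfl, rfl, rfl⟩, fun _ y _ _ => hc y, fun x => ⟨x, hc x, rfl⟩,
      fun _ _ i _ _ hi => absurd hi (Nat.not_lt_zero i)⟩
  | succ j ih =>
    rw [rules, exec_append]
    set c1 := exec G (rules M (Fintype.card V) j) c with hc1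
    obtain ⟨hb, hr⟩ := ih
    have := ruleStep_spec (G := G) (c := c1) (by rw [hb.cids_eq, hb.deps_eq]; exact h) j
      (by rw [hb.cids_eq]; exact hr.consistent)
    obtain ⟨hb', hr'⟩ := this
    refine ⟨hb.trans hb', hr.succ ?_⟩
    have e : (fun x => suppressor j (c1 x).core) =
        fun x => (c1 x).core.cand ∧ (cids c x).testBit j = false := by
      funext x
      rw [suppressor, ← (hb x).2.1]
    rw [e, hb.cids_eq] at hr'
    exact hr'

end ClusterBroadcast
-- Growing new clusters, and iterating phases
namespace ClusterBroadcast
variable {M : Type u} {V : Type v}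

/-- The clusters of the ruling set become the first new clusters. -/
def seedSlot (M : Type u) : Slot M :=
  localSlot fun x _ => { x with asg := x.cand, ncid := x.cid, nlab := x.dep }

open Classical in
/-- The memory of a device after a wave with result `r`. -/
noncomputable def join (x : Core M) (r : Option (Token M)) : Core M :=
  if x.asg then x else match r with
    | none => x
    | some q => { x with asg := True, ncid := q.1.1, nlab := q.2 }

theorem join_of_asg {x : Core M} (h : x.asg) (r : Option (Token M)) : join x r = x :=
  if_pos h

theorem join_none (x : Core M) : join x none = x :=
  ite_self x

theorem join_some {x : Core M} (h : ¬ x.asg) (q : Token M) :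
    join x (some q) = { x with asg := True, ncid := q.1.1, nlab := q.2 } :=
  if_neg h

/-- The clusters that are not yet assigned join adjacent new clusters. -/
noncomputable def wave (M : Type u) (n : ℕ) : List (Slot M) :=
  hop n Core.asg ++ [localSlot join]

/-- A sequence of waves. -/
noncomputable def waves (M : Type u) (n : ℕ) : ℕ → List (Slot M)
  | 0 => []
  | i + 1 => waves M n i ++ wave M n

/-- The new clusters replace the old ones. -/
def renameSlot (M : Type u) : Slot M :=
  localSlot fun x _ => { x with cid := x.ncid, dep := x.nlab, cand := True }

/-- The clusters are merged, where the names of clusters have `b` bits. -/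
noncomputable def phase (M : Type u) (n b : ℕ) : List (Slot M) :=
  rules M n b ++ (seedSlot M :: (waves M n (2 * b) ++ [renameSlot M]))

/-- A sequence of phases. -/
noncomputable def phases (M : Type u) (n b : ℕ) : ℕ → List (Slot M)
  | 0 => []
  | i + 1 => phases M n b i ++ phase M n b

variable {G : SimpleGraph V}

/-- The new clusters have grown around the clusters in `R` for `i` steps. -/
structure Grown (G : SimpleGraph V) (R : V → Prop) (i : ℕ) (c : V → Dev M) : Prop where
  consistent : Consistent (cids c) fun x => (c x).core.asg
  of_nlab_eq_zero : ∀ x, (c x).core.asg → (c x).core.nlab = 0 →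
    (c x).core.ncid = cids c x ∧ deps c x = 0
  exists_parent : ∀ x, (c x).core.asg → 0 < (c x).core.nlab → ∃ y, G.Adj x y ∧ (c y).core.asg ∧
    (c y).core.ncid = (c x).core.ncid ∧ (c y).core.nlab + 1 = (c x).core.nlab
  exists_name : ∀ x, (c x).core.asg → ∃ r, R r ∧ cids c r = (c x).core.ncid
  asg_of_dist : ∀ x r, R r → ClusterDistLE G (cids c) i x r → (c x).core.asg

theorem grown_seed {c : V → Dev M} (h : IsLayering G (cids c) (deps c))
    (hc : Consistent (cids c) fun x => (c x).core.cand) :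
    SameBase c ((seedSlot M).exec G c) ∧
      Grown G (fun x => (c x).core.cand) 0 ((seedSlot M).exec G c) := by
  refine ⟨fun _ => ⟨rfl, rfl, rfl⟩, hc, fun x _ h0 => ⟨rfl, h0⟩, fun x hx h0 => ?_,
    fun x hx => ⟨x, hx, rfl⟩, fun x r hr hxr => hc r x (Eq.symm hxr) hr⟩
  obtain ⟨y, hy, h1, h2⟩ := h.exists_parent x h0
  exact ⟨y, hy, hc x y h1.symm hx, h1, h2⟩

/-- Agreement on the payload makes each old cluster join a single new cluster as a whole, while the
counters become the new layers. -/
theorem grown_wave [Fintype V] {c : V → Dev M} (h : IsLayering G (cids c) (deps c))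
    {R : V → Prop} {i : ℕ} (hg : Grown G R i c) :
    SameBase c (exec G (wave M (Fintype.card V)) c) ∧
      Grown G R (i + 1) (exec G (wave M (Fintype.card V)) c) := by
  set c' := exec G (wave M (Fintype.card V)) c with hc'
  set c1 := exec G (hop (Fintype.card V) Core.asg) c with hc1
  have s : HopSpec G (fun v => (c v).core.asg) c c1 := hopSpec G h _
  have e' : ∀ x, (c' x).core = join (c x).core (c1 x).res := by
    intro x
    rw [hc', wave, exec_append, ← s.core_eq]
    rfl
  have old : ∀ x, (c x).core.asg → (c' x).core = (c x).core := by
    intro x hx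
    rw [e', join_of_asg hx]
  have idle : ∀ x, (c1 x).res = none → (c' x).core = (c x).core := by
    intro x hx
    rw [e', hx, join_none]
  have new : ∀ x p k, ¬ (c x).core.asg → (c1 x).res = some (p, k) →
      (c' x).core = { (c x).core with asg := True, ncid := p.1, nlab := k } := by
    intro x p k hx hr
    rw [e', hr, join_some hx]
  have cases : ∀ x, (c' x).core.asg → (c x).core.asg ∨
      ¬ (c x).core.asg ∧ ∃ p k, (c1 x).res = some (p, k) := by
    intro x hx
    by_cases h0 : (c x).core.asg
    · exact Or.inl h0
    · refine Or.inr ⟨h0, ?_⟩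
      rcases hr : (c1 x).res with _ | ⟨p, k⟩
      · rw [idle x hr] at hx
        exact absurd hx h0
      · exact ⟨p, k, rfl⟩
  have asg_of_res : ∀ x, (c1 x).res ≠ none → (c' x).core.asg := by
    intro x hx
    by_cases h0 : (c x).core.asg
    · rwa [old x h0]
    · obtain ⟨⟨p, k⟩, hr⟩ := Option.ne_none_iff_exists'.1 hx
      rw [new x p k h0 hr]
      trivial
  have hb : SameBase c c' := by
    intro x
    rw [cids, deps]
    by_cases h0 : (c x).core.asg
    · rw [old x h0]
      exact ⟨rfl, rfl, rfl⟩
    · rcases hr : (c1 x).res with _ | ⟨p, k⟩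
      · rw [idle x hr]
        exact ⟨rfl, rfl, rfl⟩
      · rw [new x p k h0 hr]
        exact ⟨rfl, rfl, rfl⟩
  have hcid : cids c' = cids c := hb.cids_eq
  refine ⟨hb, ?_, ?_, ?_, ?_, ?_⟩
  · intro x y hxy hx
    rw [hcid] at hxy
    rcases cases x hx with h0 | ⟨h0, p, k, hr⟩
    · have := hg.consistent x y hxy h0
      simp only at this
      rwa [old y this]
    · refine asg_of_res y fun hy => ?_
      have := s.payload_eq x y hxy
      rw [hr, hy] at this
      cases this
  · intro x hx hx0
    rw [hcid, hb.deps_eq]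
    rcases cases x hx with h0 | ⟨h0, p, k, hr⟩
    · rw [old x h0] at hx0 ⊢
      exact hg.of_nlab_eq_zero x h0 hx0
    · rw [new x p k h0 hr] at hx0
      simp only at hx0
      -- Newly assigned layers are positive, so joining creates no second root.
      rcases s.chain x p k hr with ⟨u, -, -, -, hk⟩ | ⟨y, k', -, -, -, hk⟩ <;> omega
  · intro x hx hx0
    rcases cases x hx with h0 | ⟨h0, p, k, hr⟩
    · rw [old x h0] at hx0 ⊢
      obtain ⟨y, hy, h1, h2, h3⟩ := hg.exists_parent x h0 hx0
      refine ⟨y, hy, ?_⟩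
      rw [old y h1]
      exact ⟨h1, h2, h3⟩
    · rw [new x p k h0 hr]
      -- The new parent is an earlier member across the border, or a device of the same old cluster
      -- that joins in this wave.
      rcases s.chain x p k hr with ⟨u, hu, h1, h2, hk⟩ | ⟨y, k', hy, h1, h2, hk⟩
      · refine ⟨u, hu, ?_⟩
        rw [old u h1]
        exact ⟨h1, h2, hk.symm⟩
      · refine ⟨y, hy, ?_⟩
        rw [new y p k' (fun h' => h0 (hg.consistent y x h1 h')) h2]
        exact ⟨trivial, rfl, hk.symm⟩
  · intro x hx
    rw [hcid]
    rcases cases x hx with h0 | ⟨h0, p, k, hr⟩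
    · rw [old x h0]
      exact hg.exists_name x h0
    · rw [new x p k h0 hr]
      obtain ⟨u, hu, h1⟩ := s.exists_ncid x p k hr
      obtain ⟨r, hr, h2⟩ := hg.exists_name u hu
      exact ⟨r, hr, h2.trans h1⟩
  · intro x r hr hxr
    rw [hcid] at hxr
    by_cases h0 : (c x).core.asg
    · rwa [old x h0]
    · rcases hxr with hxr | ⟨z, hz, hzr⟩
      · exact absurd (hg.asg_of_dist x r hr hxr) h0
      · exact asg_of_res x ((s.res_ne_none_iff_of_consistent hg.consistent x).2
          ⟨h0, z, hz, hg.asg_of_dist z r hr hzr⟩)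

theorem grown_waves [Fintype V] {c : V → Dev M} (h : IsLayering G (cids c) (deps c))
    {R : V → Prop} (hg : Grown G R 0 c) (i : ℕ) :
    SameBase c (exec G (waves M (Fintype.card V) i) c) ∧
      Grown G R i (exec G (waves M (Fintype.card V) i) c) := by
  induction i with
  | zero => exact ⟨fun _ => ⟨rfl, rfl, rfl⟩, hg⟩
  | succ i ih =>
    rw [waves, exec_append]
    obtain ⟨hb, hg'⟩ := ih
    obtain ⟨hb', hg''⟩ := grown_wave (by rw [hb.cids_eq, hb.deps_eq]; exact h) hg'
    exact ⟨hb.trans hb', hg''⟩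

/-- The situation between two phases. -/
structure IsClustering (G : SimpleGraph V) (N : ℕ) (c : V → Dev M) : Prop where
  layering : IsLayering G (cids c) (deps c)
  cand : ∀ x, (c x).core.cand
  cid_le : ∀ x, cids c x ≤ N

/-- Domination within `2 * b` hops means that `2 * b` waves reach everyone. New clusters keep the
names of their seeds, so names stay at most `N` and `b` bits suffice again. -/
theorem phase_spec [Fintype V] (hG : G.Connected) {N b : ℕ} (hN : N < 2 ^ b) {c : V → Dev M}
    (h : IsClustering G N c) :
    let c' := exec G (phase M (Fintype.card V) b) c
    IsClustering G N c' ∧ (∀ x, (c' x).core.msg = (c x).core.msg) ∧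
      (Finset.univ.image (cids c')).card ≤ max 1 ((Finset.univ.image (cids c)).card / 2) := by
  intro c'
  set c1 := exec G (rules M (Fintype.card V) b) c with hc1
  obtain ⟨b1, hr⟩ := rules_spec h.layering h.cand b
  rw [← hc1] at b1 hr
  have l1 : IsLayering G (cids c1) (deps c1) := by
    rw [b1.cids_eq, b1.deps_eq]
    exact h.layering
  obtain ⟨b2, g2⟩ := grown_seed l1 (by rw [b1.cids_eq]; exact hr.consistent)
  set c2 := (seedSlot M).exec G c1 with hc2
  have b12 := b1.trans b2
  obtain ⟨b3, g3⟩ := grown_waves (by rw [b12.cids_eq, b12.deps_eq]; exact h.layering) g2 (2 * b)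
  set c3 := exec G (waves M (Fintype.card V) (2 * b)) c2 with hc3
  have b13 := b12.trans b3
  have e' : ∀ x, (c' x).core =
      { (c3 x).core with cid := (c3 x).core.ncid, dep := (c3 x).core.nlab, cand := True } := by
    intro x
    simp only [c', phase, exec_append, exec_cons, exec_nil]
    rfl
  have hasg : ∀ x, (c3 x).core.asg := by
    intro x
    obtain ⟨u, hu, hxu⟩ := hr.dominating x
    exact g3.asg_of_dist x u hu (by rw [b13.cids_eq]; exact hxu)
  have hcid : ∀ x, cids c' x = (c3 x).core.ncid := fun x => by rw [cids, e']
  have hdep : ∀ x, deps c' x = (c3 x).core.nlab := fun x => by rw [deps, e']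
  have hname : ∀ x, ∃ r, (c1 r).core.cand ∧ cids c r = cids c' x := by
    intro x
    obtain ⟨r, hr, hrx⟩ := g3.exists_name x (hasg x)
    exact ⟨r, hr, by rw [hcid, ← hrx, b13.cids_eq]⟩
  refine ⟨⟨⟨fun x hx => ?_, fun x y hxy hx hy => ?_⟩, fun x => ?_, fun x => ?_⟩, fun x => ?_,
    card_image_le_half hG (R := fun r => (c1 r).core.cand) ?_ hname⟩
  · rw [hdep] at hx
    obtain ⟨y, hy, -, h1, h2⟩ := g3.exists_parent x (hasg x) hx
    exact ⟨y, hy, by rw [hcid, hcid, h1], by rw [hdep, hdep, h2]⟩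
  · rw [hdep] at hx hy
    obtain ⟨x1, x2⟩ := g3.of_nlab_eq_zero x (hasg x) hx
    obtain ⟨y1, y2⟩ := g3.of_nlab_eq_zero y (hasg y) hy
    rw [hcid, hcid, x1, y1, b13.cids_eq] at hxy
    rw [b13.deps_eq] at x2 y2
    exact h.layering.root_unique x y hxy x2 y2
  · rw [e']
    trivial
  · obtain ⟨r, -, hr⟩ := hname x
    rw [← hr]
    exact h.cid_le r
  · rw [e']
    exact (b13 x).1
  -- Different names differ in some bit, and all bits from `b` on vanish, so the separation after
  -- `b` steps applies.
  · intro x y hx hy hxy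
    have : ∃ i, (cids c x).testBit i ≠ (cids c y).testBit i := by
      by_contra! h'
      exact hxy (Nat.eq_of_testBit_eq h')
    obtain ⟨i, hi⟩ := this
    refine hr.separated x y i hx hy ?_ hi
    by_contra hbi
    have hz : ∀ z, (cids c z).testBit i = false := fun z => Nat.testBit_lt_two_pow
      (((h.cid_le z).trans_lt hN).trans_le (Nat.pow_le_pow_right (by decide) (by omega)))
    exact hi (by rw [hz, hz])

theorem phases_spec [Fintype V] (hG : G.Connected) {N b : ℕ} (hN : N < 2 ^ b) {c : V → Dev M}
    (h : IsClustering G N c) (i : ℕ) (hi : (Finset.univ.image (cids c)).card < 2 ^ i) :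
    let c' := exec G (phases M (Fintype.card V) b i) c
    IsClustering G N c' ∧ (∀ x, (c' x).core.msg = (c x).core.msg) ∧
      (Finset.univ.image (cids c')).card ≤ 1 := by
  suffices key : ∀ i, IsClustering G N (exec G (phases M (Fintype.card V) b i) c) ∧
      (∀ x, (exec G (phases M (Fintype.card V) b i) c x).core.msg = (c x).core.msg) ∧
      (Finset.univ.image (cids (exec G (phases M (Fintype.card V) b i) c))).card ≤
        max 1 ((Finset.univ.image (cids c)).card / 2 ^ i) by
    obtain ⟨h1, h2, h3⟩ := key i
    rw [Nat.div_eq_of_lt hi] at h3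
    exact ⟨h1, h2, h3⟩
  intro i
  clear hi
  induction i with
  | zero => exact ⟨h, fun _ => rfl, by simp [phases]⟩
  | succ i ih =>
    rw [phases, exec_append]
    obtain ⟨h1, h2, h3⟩ := ih
    obtain ⟨h4, h5, h6⟩ := phase_spec hG hN h1
    refine ⟨h4, fun x => (h5 x).trans (h2 x), h6.trans ?_⟩
    -- Repeated halving with rounding down equals a single division by `2 ^ (i + 1)`.
    rw [pow_succ, ← Nat.div_div_eq_div_mul]
    omega

end ClusterBroadcast
-- The complete program and its correctness
namespace ClusterBroadcast
variable {M : Type u} {V : Type v}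

/-- The devices that know the message adopt it as their value. -/
def loadSlot (M : Type u) : Slot M where
  snd _ := False
  lis _ := False
  upd x _ := { x with val := x.core.msg.map fun m => ((0, some m), 0) }

/-- The message is learned from the result of the communication in the cluster. -/
def storeSlot (M : Type u) : Slot M :=
  localSlot fun x r => { x with msg := r.bind fun q => q.1.2 }

/-- The message is distributed in each cluster. -/
noncomputable def spread (M : Type u) (n : ℕ) : List (Slot M) :=
  loadSlot M :: (gather M n ++ [storeSlot M])

/-- The program for broadcasting. -/
noncomputable def program (M : Type u) (n N : ℕ) : List (Slot M) :=
  -- For `n = 1` both bounds are 0, so no slot may be used; the source already knows the message.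
  if n ≤ 1 then [] else
    phases M n (Nat.log 2 N + 1) (Nat.log 2 n + 1) ++ spread M n

section Correctness

variable [Fintype V] {G : SimpleGraph V}

/-- Only the source loads a value, so the payload agreed on in the single cluster must be `m`. -/
theorem spread_spec {c : V → Dev M} (h : IsLayering G (cids c) (deps c))
    (hcid : ∀ x y, cids c x = cids c y) {s : V} {m : M}
    (hs : (c s).core.msg = some m) (hm : ∀ x, x ≠ s → (c x).core.msg = none) (w : V) :
    (exec G (spread M (Fintype.card V)) c w).core.msg = some m := by
  set c1 := (loadSlot M).exec G c with hc1
  set c2 := exec G (gather M (Fintype.card V)) c1 with hc2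
  have g : GatherSpec G c1 c2 := gatherSpec G h
  have e : (exec G (spread M (Fintype.card V)) c w).core.msg =
      (c2 w).res.bind fun q => q.1.2 := by
    simp only [spread, exec_append, exec_cons, exec_nil]
    rfl
  have hval : ∀ x, (c1 x).val = (c x).core.msg.map fun m => ((0, some m), 0) := fun _ => rfl
  have h0 : (c2 w).res ≠ none := g.res_ne_none w s (hcid s w) (by rw [hval, hs]; simp)
  obtain ⟨⟨p, k⟩, hr⟩ := Option.ne_none_iff_exists'.1 h0
  obtain ⟨y, -, k', hy⟩ := g.exists_val w p k hr
  rw [hval] at hy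
  have hys : y = s := by
    by_contra hne
    rw [hm y hne] at hy
    cases hy
  rw [hys, hs, Option.map_some] at hy
  obtain ⟨rfl, -⟩ := Prod.mk.inj (Option.some.inj hy)
  rw [e, hr]
  rfl

theorem program_correct (hG : G.Connected) {N : ℕ} {ident : V → ℕ}
    (hinj : Function.Injective ident) (hN : ∀ w, ident w ≤ N) (s : V) (m : M) (w : V) :
    (exec G (program M (Fintype.card V) N) (initConfig ident s m) w).core.msg = some m := by
  have hs : (initConfig ident s m s).core.msg = some m := by
    simp [initConfig, initDev]
  have hm : ∀ x, x ≠ s → (initConfig ident s m x).core.msg = none := by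
    intro x hx
    simp [initConfig, initDev, hx]
  rw [program]
  split_ifs with h1
  · have := Fintype.card_le_one_iff.1 h1 w s
    rw [this, exec_nil, hs]
  rw [exec_append]
  -- Initially every device is a cluster of its own, named by its identifier, with all layers 0.
  have h0 : IsClustering G N (initConfig ident s m) :=
    ⟨⟨fun x hx => absurd hx (lt_irrefl 0), fun x y hxy _ _ => hinj hxy⟩, fun _ => trivial, hN⟩
  obtain ⟨h2, h3, h4⟩ := phases_spec hG (Nat.lt_pow_succ_log_self one_lt_two N) h0
    (Nat.log 2 (Fintype.card V) + 1)
    (Finset.card_image_le.trans_lt (Nat.lt_pow_succ_log_self one_lt_two _))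
  refine spread_spec h2.layering (fun x y => Finset.card_le_one.1 h4 _ ?_ _ ?_)
    ((h3 s).trans hs) (fun x hx => (h3 x).trans (hm x hx)) w
  · exact Finset.mem_image_of_mem _ (Finset.mem_univ _)
  · exact Finset.mem_image_of_mem _ (Finset.mem_univ _)

end Correctness

/-! ### Counting slots and energy -/

section Length

variable (M) (n b : ℕ)

theorem length_ups (k : ℕ) : (ups M k).length = k := by
  induction k with
  | zero => rfl
  | succ k ih => rw [ups, List.length_cons, ih]

theorem length_downs (k : ℕ) : (downs M k).length = k := by
  induction k with
  | zero => rfl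
  | succ k ih => rw [downs, List.length_append, ih, List.length_singleton]

theorem length_gather : (gather M n).length = 2 * n + 1 := by
  simp only [gather, List.length_append, length_ups, length_downs, List.length_singleton]
  omega

variable {M} in
theorem length_hop (snd : Core M → Prop) : (hop n snd).length = 2 * n + 2 := by
  rw [hop, List.length_cons, length_gather]

theorem length_rules : (rules M n b).length = b * (4 * n + 6) := by
  induction b with
  | zero => simp [rules]
  | succ j ih =>
    simp only [rules, ruleStep, List.length_append, ih, length_hop, List.length_cons,
      List.length_nil]
    ring

theorem length_waves (i : ℕ) : (waves M n i).length = i * (2 * n + 3) := by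
  induction i with
  | zero => simp [waves]
  | succ j ih =>
    simp only [waves, wave, List.length_append, ih, length_hop, List.length_cons,
      List.length_nil]
    ring

theorem length_phases (i : ℕ) : (phases M n b i).length = i * (b * (8 * n + 12) + 2) := by
  induction i with
  | zero => simp [phases]
  | succ j ih =>
    simp only [phases, phase, List.length_append, ih, length_rules, length_waves, List.length_cons,
      List.length_nil]
    ring

theorem length_spread : (spread M n).length = 2 * n + 3 := by
  simp only [spread, length_gather, List.length_append, List.length_cons, List.length_nil]

end Length

section Energy

variable (G : SimpleGraph V) (c : V → Dev M) (v : V)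

theorem cost_localSlot (f : Core M → Option (Token M) → Core M) :
    cost G [localSlot f] c v = 0 := by
  simp [cost, localSlot]

theorem cost_cons_localSlot (f : Core M → Option (Token M) → Core M) (p : List (Slot M)) :
    cost G (localSlot f :: p) c v = cost G p ((localSlot f).exec G c) v := by
  simp [cost, localSlot]

theorem cost_ups_le (k : ℕ) : cost G (ups M k) c v ≤
    (if deps c v < k then 1 else 0) + if 0 < deps c v ∧ deps c v ≤ k then 1 else 0 := by
  classical
  induction k generalizing c with
  | zero => simp [ups, cost]
  | succ k ih =>
    have h1 := ih ((upSlot M (k + 1)).exec G c)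
    have h2 : deps ((upSlot M (k + 1)).exec G c) v = deps c v := rfl
    have h3 : (upSlot M (k + 1)).snd (c v) ∨ (upSlot M (k + 1)).lis (c v) ↔
        deps c v = k + 1 ∨ deps c v + 1 = k + 1 := Iff.rfl
    rw [h2] at h1
    rw [ups, cost, if_congr h3 rfl rfl]
    split_ifs at h1 ⊢ <;> omega

theorem cost_downs_le (k : ℕ) : cost G (downs M k) c v ≤
    (if deps c v < k then 1 else 0) + if 0 < deps c v ∧ deps c v ≤ k then 1 else 0 := by
  classical
  induction k with
  | zero => simp [downs, cost]
  | succ k ih =>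
    set c1 := exec G (downs M k) c with hc1
    have h2 : deps c1 v = deps c v := by rw [deps, hc1, downs_core]
    have h3 : (downSlot M (k + 1)).snd (c1 v) ∨ (downSlot M (k + 1)).lis (c1 v) ↔
        deps c1 v + 1 = k + 1 ∨ deps c1 v = k + 1 := Iff.rfl
    rw [h2] at h3
    rw [downs, cost_append, cost, cost, if_congr h3 rfl rfl]
    split_ifs at ih ⊢ <;> omega

theorem cost_gather_le (n : ℕ) : cost G (gather M n) c v ≤ 4 := by
  rw [gather, cost_append, cost_append]
  have h1 := cost_ups_le G c v n
  have h2 := cost_downs_le G (exec G [rootSlot M] (exec G (ups M n) c)) v n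
  have h3 : cost G [rootSlot M] (exec G (ups M n) c) v = 0 := by simp [cost, rootSlot]
  split_ifs at h1 h2 <;> omega

theorem cost_hop_le (n : ℕ) (snd : Core M → Prop) : cost G (hop n snd) c v ≤ 5 := by
  rw [hop, cost]
  have := cost_gather_le G ((borderSlot snd).exec G c) v n
  split_ifs <;> omega

theorem cost_rules_le (n j : ℕ) : cost G (rules M n j) c v ≤ 10 * j := by
  induction j with
  | zero => simp [rules, cost]
  | succ j ih =>
    rw [rules, ruleStep, cost_append, cost_append, cost_cons_localSlot, cost_append,
      cost_localSlot]
    have h1 := cost_hop_le G (exec G (rules M n j) c) v n (suppressor j)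
    have h2 := fun c : V → Dev M => cost_hop_le G c v n Core.near
    grw [h1, h2, ih]
    omega

theorem cost_waves_le (n i : ℕ) : cost G (waves M n i) c v ≤ 5 * i := by
  induction i with
  | zero => simp [waves, cost]
  | succ i ih =>
    rw [waves, wave, cost_append, cost_append, cost_localSlot]
    grw [cost_hop_le, ih]
    omega

theorem cost_phases_le (n b i : ℕ) : cost G (phases M n b i) c v ≤ i * (20 * b) := by
  induction i with
  | zero => simp [phases, cost]
  | succ i ih =>
    rw [phases, phase, cost_append, cost_append, seedSlot, cost_cons_localSlot, cost_append,
      renameSlot, cost_localSlot]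
    grw [cost_rules_le, cost_waves_le, ih]
    apply le_of_eq
    ring

theorem cost_spread_le (n : ℕ) : cost G (spread M n) c v ≤ 4 := by
  rw [spread, cost, cost_append, storeSlot, cost_localSlot]
  grw [cost_gather_le]
  simp [loadSlot]

end Energy

theorem length_program_le (M : Type u) {n N : ℕ} (hn : 2 ≤ n) :
    (program M n N).length ≤ 25 * n * (Nat.log 2 n + 1) * (Nat.log 2 N + 1) := by
  rw [program, if_neg (by omega), List.length_append, length_phases, length_spread]
  generalize Nat.log 2 n = p
  generalize Nat.log 2 N = b
  -- For `n ≥ 2`, `8 * n + 12 ≤ 14 * n` and `2 ≤ n * (b + 1)`.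
  have h1 : (b + 1) * (8 * n + 12) + 2 ≤ 15 * n * (b + 1) := by nlinarith
  have h2 : 2 * n + 3 ≤ 10 * n * (p + 1) * (b + 1) := by
    have h3 : 1 ≤ (p + 1) * (b + 1) := Nat.mul_pos p.succ_pos b.succ_pos
    calc 2 * n + 3 ≤ 10 * n * 1 := by omega
      _ ≤ 10 * n * ((p + 1) * (b + 1)) := Nat.mul_le_mul_left _ h3
      _ = _ := by ring
  calc (p + 1) * ((b + 1) * (8 * n + 12) + 2) + (2 * n + 3)
      ≤ (p + 1) * (15 * n * (b + 1)) + 10 * n * (p + 1) * (b + 1) :=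
        Nat.add_le_add (Nat.mul_le_mul_left _ h1) h2
    _ = _ := by ring

theorem cost_program_le (G : SimpleGraph V) (c : V → Dev M) (v : V) {n N : ℕ} (hn : 2 ≤ n) :
    cost G (program M n N) c v ≤ 25 * (Nat.log 2 n + 1) * (Nat.log 2 N + 1) := by
  rw [program, if_neg (by omega), cost_append]
  grw [cost_phases_le, cost_spread_le]
  generalize Nat.log 2 n = p
  generalize Nat.log 2 N = b
  nlinarith [Nat.zero_le (p * b)]

theorem natLog_add_one_le {n : ℕ} (hn : 2 ≤ n) :
    ((Nat.log 2 n + 1 : ℕ) : ℝ) ≤ 2 * Real.logb 2 n := by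
  have h1 : ((Nat.log 2 n : ℕ) : ℝ) ≤ Real.logb 2 n := Real.natLog_le_logb n 2
  have h2 : (1 : ℝ) ≤ ((Nat.log 2 n : ℕ) : ℝ) := by
    exact_mod_cast Nat.log_pos one_lt_two hn
  push_cast
  linarith

end ClusterBroadcast

open ClusterBroadcast in
theorem mainTheorem11 :
    ∃ C : ℝ, 0 < C ∧ ∀ M : Type u, ∃ A : RadioAlgorithm M,
      ∀ (V : Type v) [Fintype V] (G : SimpleGraph V), G.Connected →
      ∀ (N : ℕ) (ident : V → ℕ), Function.Injective ident →
        (∀ w, 1 ≤ ident w ∧ ident w ≤ N) →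
      ∀ (s : V) (m : M),
        ∃ T : ℕ,
          (T : ℝ) ≤ C * Fintype.card V * Real.logb 2 (Fintype.card V) * Real.logb 2 N ∧
          (∀ w, A.output (A.run G N ident s m T w) = some m) ∧
          (∀ w, (A.energy G N ident s m T w : ℝ) ≤
            C * Real.logb 2 (Fintype.card V) * Real.logb 2 N) := by
  -- 100 = 25 · 2 · 2: each factor `Nat.log + 1` costs a factor 2 by `natLog_add_one_le`.
  refine ⟨100, by norm_num, fun M => ⟨ofProgram M (program M), ?_⟩⟩
  intro V _ G hG N ident hinj hident s m
  set n := Fintype.card V with hn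
  -- Distinct identifiers force `n ≤ N`, so `N ≥ 2` whenever `n ≥ 2`, as the estimate of log `N`
  -- requires.
  have hnN : n ≤ N := by
    have := Finset.card_le_card_of_injOn (s := Finset.univ) (t := Finset.Icc 1 N) ident
      (fun w _ => Finset.mem_coe.2 (Finset.mem_Icc.2 (hident w))) hinj.injOn
    simpa using this
  refine ⟨(program M n N).length, ?_, fun w => ?_, fun w => ?_⟩
  · rcases Nat.lt_or_ge 1 n with h1 | h1
    · calc ((program M n N).length : ℝ)
          ≤ ((25 * n * (Nat.log 2 n + 1) * (Nat.log 2 N + 1) : ℕ) : ℝ) := by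
            exact_mod_cast length_program_le M h1
        _ = 25 * n * ((Nat.log 2 n + 1 : ℕ) : ℝ) * ((Nat.log 2 N + 1 : ℕ) : ℝ) := by
            push_cast
            ring
        _ ≤ 25 * n * (2 * Real.logb 2 n) * (2 * Real.logb 2 N) := by
            have h2 := natLog_add_one_le h1
            have h3 := natLog_add_one_le (h1.trans_le hnN)
            have h4 := (Nat.cast_nonneg (α := ℝ) _).trans h2
            gcongr
        _ = _ := by ring
    · have : n = 1 := le_antisymm h1 (Fintype.card_pos_iff.2 ⟨s⟩)
      simp [program, this]
  · rw [output_run_length]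
    exact program_correct hG hinj (fun w => (hident w).2) s m w
  · have h0 := energy_length_le (program M) G N ident s m w
    rcases Nat.lt_or_ge 1 n with h1 | h1
    · calc ((ofProgram M (program M)).energy G N ident s m (program M n N).length w : ℝ)
          ≤ ((25 * (Nat.log 2 n + 1) * (Nat.log 2 N + 1) : ℕ) : ℝ) := by
            exact_mod_cast h0.trans (cost_program_le G _ w h1)
        _ = 25 * ((Nat.log 2 n + 1 : ℕ) : ℝ) * ((Nat.log 2 N + 1 : ℕ) : ℝ) := by
            push_cast
            ring
        _ ≤ 25 * (2 * Real.logb 2 n) * (2 * Real.logb 2 N) := by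
            have h2 := natLog_add_one_le h1
            have h3 := natLog_add_one_le (h1.trans_le hnN)
            have h4 := (Nat.cast_nonneg (α := ℝ) _).trans h2
            gcongr
        _ = _ := by ring
    · have : n = 1 := le_antisymm h1 (Fintype.card_pos_iff.2 ⟨s⟩)
      simp [program, this, RadioAlgorithm.energy]
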